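/- Let $\mathcal X,\mathcal Y$ be finite non-empty alphabets, $W(k|j)$ ($j\in\mathcal X$, $k\in\mathcal Y$) a discrete memoryless channel and $q:\mathcal X\times\mathcal Y\to\mathbb R$ a decoding metric; $\log$ denotes $\log_2$. For $k_1,k_2\in\mathcal Y$ let $\mathcal S_q(k_1,k_2)$ be the set of all $i\in\mathcal X$ that maximize $q(i,k_2)-q(i,k_1)$. A conditional distribution $P_{Y\hat Y|X}$ of a pair $(Y,\hat Y)\in\mathcal Y\times\mathcal Y$ given $X\in\mathcal X$ is called \emph{maximal} if $P_{Y\hat Y|X}(k_1,k_2|j)=0$ whenever $j\notin\mathcal S_q(k_1,k_2)$; let $\mathcal M_{\max}(q)$ be the set of these. Put $I(P_X,V)=\sum_{j,k}P_X(j)V(k|j)\log\frac{V(k|j)}{\sum_{j'}P_X(j')V(k|j')}$ (terms with $P_X(j)V(k|j)=0$ are $0$) and $$\bar R_q(W)=\max_{P_X}\ \min_{\substack{P_{Y\hat Y|X}\in\mathcal M_{\max}(q)\\ P_{Y|X}=W}} I(P_X,P_{\hat Y|X}),$$ where $P_X$ ranges over all probability distributions on $\mathcal X$ and $P_{Y|X},P_{\hat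 Y|X}$ are the marginals of $P_{Y\hat Y|X}$; the minimum (for every $P_X$) and the maximum are attained. A codebook of length $n$ is a set $\mathcal C_n\subseteq\mathcal X^n$. Put $q(x,y)=\sum_{i=1}^n q(x_i,y_i)$ for $x\in\mathcal X^n$, $y\in\mathcal Y^n$. When $x\in\mathcal C_n$ is sent, $y\in\mathcal Y^n$ is received with probability $W^n(y|x)=\prod_{i=1}^nW(y_i|x_i)$, and the $q$-decoder is correct if and only if $q(x,y)>q(x',y)$ for all $x'\in\mathcal C_n\setminus\{x\}$ (ties are errors). Let $P^q_{e,\max}(\mathcal C_n)$ and $P^q_e(\mathcal C_n)$ be the maximum and the average over $x\in\mathcal C_n$ of the probability of error given that $x$ is sent. A rate $R>0$ is achievable if for every $\varepsilon>0$ there are codebooks $\mathcal C_n$ of length $n=1,2,\dots$ with $|\mathcal C_n|\ge 2^{n(R-\varepsilon)}$ and $\liminf_{n\to\infty}P^q_e(\mathcal C_n)=0$; the mismatch capacity $C_q(W)$ is the supremum of all achievable rates ($0$ if there are none). \textbf{Theorem.} If $R>\bar R_q(W)$, then there are $n_0\in\mathbb N$ and $\bar E_q(R)>0$ such that for all $n>n_0$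 every codebook $\mathcal C_n$ of length $n$ with at least $2^{nR}$ codewords satisfies $$P^q_{e,\max}(\mathcal C_n)\ \ge\ 1-2^{-n\bar E_q(R)}.$$ Consequently every achievable rate is at most $\bar R_q(W)$, that is, $C_q(W)\le\bar R_q(W)$. -/

import Mathlib

open Filter Topology

namespace Mismatch

/-- `W j k` is the probability `W(k|j)`: every row of `W` is a probability vector on `B`. -/
def IsChannel {A B : Type*} [Fintype B] (W : A → B → ℝ) : Prop :=
  ∀ j, W j ∈ stdSimplex ℝ B

/-- The mutual information `I(P_X, P_{Y|X})` in bits,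
`∑_{j,k} P_X(j) V(k|j) log₂ (V(k|j) / ∑_{j'} P_X(j') V(k|j'))`. -/
noncomputable def mutualInfo {A B : Type*} [Fintype A] [Fintype B]
    (p : A → ℝ) (V : A → B → ℝ) : ℝ :=
  ∑ j, ∑ k, p j * V j k * Real.logb 2 (V j k / ∑ j', p j' * V j' k)

/-- The set `S_q(k₁,k₂)` of all maximizers `i` of `q(i,k₂) - q(i,k₁)`. -/
def argmaxSet {X Y : Type*} (q : X → Y → ℝ) (k₁ k₂ : Y) : Set X :=
  {i | ∀ i', q i' k₂ - q i' k₁ ≤ q i k₂ - q i k₁}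

/-- The maximal joint conditional distributions: `P j (k₁, k₂) = P_{YŶ|X}(k₁,k₂|j)` is a
conditional distribution that vanishes whenever `j ∉ S_q(k₁,k₂)`. -/
def maximalJoint {X Y : Type*} [Fintype Y] (q : X → Y → ℝ) : Set (X → Y × Y → ℝ) :=
  {P | IsChannel P ∧ ∀ j k₁ k₂, j ∉ argmaxSet q k₁ k₂ → P j (k₁, k₂) = 0}

/-- The marginal `P_{Y|X}` of `P_{YŶ|X}`. -/
def margY {X Y : Type*} [Fintype Y] (P : X → Y × Y → ℝ) : X → Y → ℝ :=
  fun j k₁ => ∑ k₂, P j (k₁, k₂)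

/-- The marginal `P_{Ŷ|X}` of `P_{YŶ|X}`. -/
def margYhat {X Y : Type*} [Fintype Y] (P : X → Y × Y → ℝ) : X → Y → ℝ :=
  fun j k₂ => ∑ k₁, P j (k₁, k₂)

/-- The maximal joint conditional distributions with `P_{Y|X} = W`. -/
def feasible {X Y : Type*} [Fintype Y] (W q : X → Y → ℝ) : Set (X → Y × Y → ℝ) :=
  {P | P ∈ maximalJoint q ∧ margY P = W}

/-- All values `I(P_X, P_{Ŷ|X})` over the feasible `P_{YŶ|X}`, for a fixed `P_X`. -/
noncomputable def innerValues {X Y : Type*} [Fintype X] [Fintype Y]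
    (W q : X → Y → ℝ) (p : X → ℝ) : Set ℝ :=
  (fun P => mutualInfo p (margYhat P)) '' feasible W q

/-- The inner minimum, for a fixed `P_X`. -/
noncomputable def innerMin {X Y : Type*} [Fintype X] [Fintype Y]
    (W q : X → Y → ℝ) (p : X → ℝ) : ℝ :=
  sInf (innerValues W q p)

/-- `R̄_q(W)`, the maximum of the inner minimum over all input distributions `P_X`. -/
noncomputable def Rbar {X Y : Type*} [Fintype X] [Fintype Y] (W q : X → Y → ℝ) : ℝ :=
  sSup (innerMin W q '' stdSimplex ℝ X)

/-- The memoryless law `W^n(y|x) = ∏ W(y_i|x_i)`. -/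
def blockLaw {X Y : Type*} {n : ℕ} (W : X → Y → ℝ) (x : Fin n → X) (y : Fin n → Y) : ℝ :=
  ∏ i, W (x i) (y i)

/-- The additive metric `q(x,y) = ∑ q(x_i,y_i)`. -/
def blockMetric {X Y : Type*} {n : ℕ} (q : X → Y → ℝ) (x : Fin n → X) (y : Fin n → Y) : ℝ :=
  ∑ i, q (x i) (y i)

/-- When the codeword `x` is sent and `y` is received, the `q`-decoder for the codebook `C` is
correct iff `x` is the unique maximizer of the metric (ties count as errors). -/
def DecodesCorrectly {X Y : Type*} {n : ℕ} (q : X → Y → ℝ) (C : Finset (Fin n → X))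
    (x : Fin n → X) (y : Fin n → Y) : Prop :=
  ∀ x' ∈ C, x' ≠ x → blockMetric q x' y < blockMetric q x y

open Classical in
/-- The `q`-decoding error probability over `W`, given that the codeword `x` is sent. -/
noncomputable def errorProb {X Y : Type*} [Fintype Y] {n : ℕ} (W q : X → Y → ℝ)
    (C : Finset (Fin n → X)) (x : Fin n → X) : ℝ :=
  ∑ y : Fin n → Y, if DecodesCorrectly q C x y then 0 else blockLaw W x y

/-- The average error probability of a codebook. -/
noncomputable def avgError {X Y : Type*} [Fintype Y] {n : ℕ} (W q : X → Y → ℝ)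
    (C : Finset (Fin n → X)) : ℝ :=
  (∑ x ∈ C, errorProb W q C x) / C.card

/-- The maximal error probability of a codebook (a maximum over a finite set). -/
noncomputable def maxError {X Y : Type*} [Fintype Y] {n : ℕ} (W q : X → Y → ℝ)
    (C : Finset (Fin n → X)) : ℝ :=
  ⨆ x : C, errorProb W q C x

/-- A rate `R > 0` is achievable with `q`-decoding if for every `ε > 0` there are codebooks
`C n` of length `n = 1, 2, …` with `|C n| ≥ 2^{n(R-ε)}` whose average error probabilities have
limit inferior `0`. -/
def Achievable {X Y : Type*} [Fintype Y] (W q : X → Y → ℝ) (R : ℝ) : Prop :=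
  0 < R ∧ ∀ ε : ℝ, 0 < ε → ∃ C : (n : ℕ) → Finset (Fin n → X),
    (∀ n : ℕ, 1 ≤ n → (2 : ℝ) ^ ((n : ℝ) * (R - ε)) ≤ ((C n).card : ℝ)) ∧
    liminf (fun n => avgError W q (C n)) atTop = 0

/-- The mismatch capacity: the supremum of all achievable rates (`0` if there are none). -/
noncomputable def mismatchCapacity {X Y : Type*} [Fintype Y] (W q : X → Y → ℝ) : ℝ :=
  sSup {R | Achievable W q R}

end Mismatch

-- Fix a codeword `x` and couple `Y` with `Ŷ` letter by letter through a maximal `P` with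
-- `Y`-marginal `W`. With probability one, replacing `y` by `ŷ` raises the metric of `x` at least as
-- much as that of any rival, so correct decoding from `Y` forces it from `Ŷ`
-- (`correctMass_margY_le`). Hence `W` may be replaced by `V = P_{Ŷ|X}`, chosen so that `I(p, V)` is
-- close to `R̄_q(W)` or smaller, where `p` is the type of `x`.
--
-- For `V`, compare `V^n(·|x)` with a product law `Q^n` independent of `x`
-- (`correctMass_le_of_output`): outside an exponentially small part, `V^n ≤ 2^{nρ} Q^n`. Decoding
-- regions are disjoint, so the `Q^n` masses sum to at most one over the codebook.
--
-- Since `V` and `Q` depend on `p`, compactness of the simplex reduces to finitely many choices,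
-- each serving a neighbourhood of types (`exists_sum_correctMass_le`). No constant-composition
-- subcode is needed, so the bound already holds for the average error.

namespace Mismatch

-- Compactness and continuity: the extrema are attained

section Attainment

variable {X Y : Type*} [Fintype Y]

lemma margYhat_isChannel {P : X → Y × Y → ℝ} (hP : IsChannel P) : IsChannel (margYhat P) :=
  fun j => ⟨fun _ => Finset.sum_nonneg fun _ _ => (hP j).1 _, by
    rw [← (hP j).2, Fintype.sum_prod_type_right]; rfl⟩

/-- The joint distribution under which `Ŷ = Y` is feasible. -/
lemma feasible_nonempty {W : X → Y → ℝ} (hW : IsChannel W) (q : X → Y → ℝ) :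
    (feasible W q).Nonempty := by
  classical
  refine ⟨fun j z => if z.1 = z.2 then W j z.1 else 0, ⟨fun j => ⟨fun z => ?_, ?_⟩, ?_⟩, ?_⟩
  · dsimp only
    split_ifs
    · exact (hW j).1 _
    · exact le_rfl
  · rw [Fintype.sum_prod_type]
    simpa using (hW j).2
  · intro j k₁ k₂ hj
    refine if_neg fun h => hj ?_
    dsimp only at h
    subst h
    intro i
    simp
  · ext j k
    simp [margY]

lemma isCompact_feasible (W q : X → Y → ℝ) : IsCompact (feasible W q) := by
  have hK : IsCompact {P : X → Y × Y → ℝ | IsChannel P} := by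
    have := isCompact_univ_pi fun _ : X => isCompact_stdSimplex ℝ (Y × Y)
    convert this using 1
    ext P
    simp [IsChannel]
  have hF : IsClosed {P : X → Y × Y → ℝ |
      ∀ j k₁ k₂, j ∉ argmaxSet q k₁ k₂ → P j (k₁, k₂) = 0} := by
    simp only [Set.ofPred_forall]
    exact isClosed_iInter fun j => isClosed_iInter fun k₁ => isClosed_iInter fun k₂ =>
      isClosed_iInter fun _ => isClosed_eq (by fun_prop) continuous_const
  have hM : IsClosed {P : X → Y × Y → ℝ | margY P = W} :=
    isClosed_eq (by unfold margY; fun_prop) continuous_const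
  have : feasible W q = ({P : X → Y × Y → ℝ | IsChannel P} ∩ {P : X → Y × Y → ℝ |
      ∀ j k₁ k₂, j ∉ argmaxSet q k₁ k₂ → P j (k₁, k₂) = 0}) ∩ {P | margY P = W} := rfl
  rw [this]
  exact (hK.inter_right hF).inter_right hM

variable [Fintype X]

/-- Mutual information as output entropy minus conditional entropy, in nats. -/
noncomputable def entropyDiff (p : X → ℝ) (V : X → Y → ℝ) : ℝ :=
  ∑ k, Real.negMulLog (∑ j, p j * V j k) - ∑ j, ∑ k, p j * Real.negMulLog (V j k)

/-- The quotient inside the logarithm obstructs continuity where probabilities vanish; the entropy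
form is continuous everywhere because `Real.negMulLog` is. -/
lemma mutualInfo_eq_entropyDiff {p : X → ℝ} {V : X → Y → ℝ} (hp : ∀ j, 0 ≤ p j)
    (hV : ∀ j k, 0 ≤ V j k) : mutualInfo p V = entropyDiff p V / Real.log 2 := by
  have key : ∀ j k, p j * V j k * Real.logb 2 (V j k / ∑ j', p j' * V j' k) =
      (-(p j * V j k * Real.log (∑ j', p j' * V j' k)) - p j * Real.negMulLog (V j k)) /
        Real.log 2 := by
    intro j k
    rcases eq_or_ne (p j * V j k) 0 with h | h
    · rcases mul_eq_zero.1 h with h | h <;> simp [h]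
    · have hpos : 0 < p j * V j k := lt_of_le_of_ne (mul_nonneg (hp j) (hV j k)) h.symm
      have hQ : p j * V j k ≤ ∑ j', p j' * V j' k :=
        Finset.single_le_sum (f := fun j' => p j' * V j' k)
          (fun i _ => mul_nonneg (hp i) (hV i k)) (Finset.mem_univ j)
      rw [Real.logb, Real.log_div (right_ne_zero_of_mul h) (hpos.trans_le hQ).ne',
        Real.negMulLog]
      ring
  unfold mutualInfo entropyDiff
  simp_rw [key, ← Finset.sum_div, Finset.sum_sub_distrib]
  congr 2
  rw [Finset.sum_comm]
  refine Finset.sum_congr rfl fun k _ => ?_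
  rw [Finset.sum_neg_distrib, ← Finset.sum_mul, Real.negMulLog, neg_mul]

lemma innerValues_eq_image (W q : X → Y → ℝ) {p : X → ℝ} (hp : p ∈ stdSimplex ℝ X) :
    innerValues W q p = (fun P => entropyDiff p (margYhat P) / Real.log 2) '' feasible W q :=
  Set.image_congr fun _ hP =>
    mutualInfo_eq_entropyDiff hp.1 fun j k => (margYhat_isChannel hP.1.1 j).1 k

lemma continuous_entropyDiff_margYhat :
    Continuous fun z : (X → ℝ) × (X → Y × Y → ℝ) =>
      entropyDiff z.1 (margYhat z.2) / Real.log 2 := by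
  unfold entropyDiff margYhat
  have := Real.continuous_negMulLog
  fun_prop

lemma isLeast_innerMin {W : X → Y → ℝ} (hW : IsChannel W) (q : X → Y → ℝ) {p : X → ℝ}
    (hp : p ∈ stdSimplex ℝ X) : IsLeast (innerValues W q p) (innerMin W q p) := by
  have hc : IsCompact (innerValues W q p) := by
    rw [innerValues_eq_image W q hp]
    have hc : Continuous fun P : X → Y × Y → ℝ => entropyDiff p (margYhat P) / Real.log 2 :=
      ((continuous_entropyDiff_margYhat (X := X) (Y := Y)).comp (Continuous.prodMk_right p) :)
    exact (isCompact_feasible W q).image hc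
  exact hc.isLeast_sInf ((feasible_nonempty hW q).image _)

lemma isGreatest_Rbar [Nonempty X] (W q : X → Y → ℝ) :
    IsGreatest (innerMin W q '' stdSimplex ℝ X) (Rbar W q) := by
  classical
  -- The feasible set does not depend on `p`, so joint continuity makes the minimum continuous in
  -- `p`.
  have hc := (isCompact_feasible W q).continuous_sInf
    (f := fun (p : X → ℝ) P => entropyDiff p (margYhat P) / Real.log 2)
    continuous_entropyDiff_margYhat
  have hi : IsCompact (innerMin W q '' stdSimplex ℝ X) := by
    rw [Set.image_congr (g := fun p : X → ℝ => sInf ((fun P =>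
      entropyDiff p (margYhat P) / Real.log 2) '' feasible W q))
      fun p hp => by rw [innerMin, innerValues_eq_image W q hp]]
    exact (isCompact_stdSimplex ℝ X).image hc
  exact hi.isGreatest_sSup
    (Set.Nonempty.image _ ⟨_, single_mem_stdSimplex ℝ (Classical.arbitrary X)⟩)

end Attainment

-- Decoding regions and the maximal coupling

section Decoding

variable {X Y : Type*} {n : ℕ}

/-- If every letter of `x` maximizes `q(·, ŷ_i) - q(·, y_i)`, then correct decoding of `y` to `x`
entails correct decoding of `ŷ` to `x`. -/
lemma DecodesCorrectly.of_mem_argmaxSet {q : X → Y → ℝ} {C : Finset (Fin n → X)}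
    {x : Fin n → X} {y y' : Fin n → Y} (h : DecodesCorrectly q C x y)
    (hm : ∀ i, x i ∈ argmaxSet q (y i) (y' i)) : DecodesCorrectly q C x y' := by
  intro x' hx' hne
  have h1 := h x' hx' hne
  have h2 : ∑ i, (q (x' i) (y' i) - q (x' i) (y i)) ≤ ∑ i, (q (x i) (y' i) - q (x i) (y i)) :=
    Finset.sum_le_sum fun i _ => hm i (x' i)
  simp only [Finset.sum_sub_distrib] at h2
  unfold blockMetric at *
  linarith

variable [Fintype Y]

open Classical in
/-- The mass that `μ` gives to the outputs decoded correctly to `x`. -/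
noncomputable def correctMass (q : X → Y → ℝ) (C : Finset (Fin n → X)) (x : Fin n → X)
    (μ : (Fin n → Y) → ℝ) : ℝ :=
  ∑ y : Fin n → Y, if DecodesCorrectly q C x y then μ y else 0

lemma blockLaw_nonneg {W : X → Y → ℝ} (hW : IsChannel W) (x : Fin n → X) (y : Fin n → Y) :
    0 ≤ blockLaw W x y :=
  Finset.prod_nonneg fun i _ => (hW (x i)).1 (y i)

lemma sum_blockLaw {W : X → Y → ℝ} (hW : IsChannel W) (x : Fin n → X) :
    ∑ y, blockLaw W x y = 1 := by
  unfold blockLaw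
  rw [← Fintype.prod_sum fun i k => W (x i) k]
  exact Finset.prod_eq_one fun i _ => (hW (x i)).2

lemma errorProb_eq {W : X → Y → ℝ} (hW : IsChannel W) (q : X → Y → ℝ)
    (C : Finset (Fin n → X)) (x : Fin n → X) :
    errorProb W q C x = 1 - correctMass q C x (blockLaw W x) := by
  rw [← sum_blockLaw hW x, errorProb, correctMass, ← Finset.sum_sub_distrib]
  refine Finset.sum_congr rfl fun y _ => ?_
  split_ifs <;> simp

lemma correctMass_nonneg {q : X → Y → ℝ} {C : Finset (Fin n → X)} {x : Fin n → X}
    {μ : (Fin n → Y) → ℝ} (hμ : ∀ y, 0 ≤ μ y) : 0 ≤ correctMass q C x μ :=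
  Finset.sum_nonneg fun y _ => by split_ifs <;> simp [hμ y]

/-- The correct decoding regions of distinct codewords are disjoint. -/
lemma sum_correctMass_le (q : X → Y → ℝ) (C : Finset (Fin n → X))
    {μ : (Fin n → Y) → ℝ} (hμ : ∀ y, 0 ≤ μ y) :
    ∑ x ∈ C, correctMass q C x μ ≤ ∑ y, μ y := by
  classical
  unfold correctMass
  rw [Finset.sum_comm]
  refine Finset.sum_le_sum fun y _ => ?_
  rw [← Finset.sum_filter, Finset.sum_const, nsmul_eq_mul]
  have : (C.filter fun x => DecodesCorrectly q C x y).card ≤ 1 := by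
    refine Finset.card_le_one.2 fun a ha b hb => ?_
    rw [Finset.mem_filter] at ha hb
    by_contra hne
    exact lt_asymm (ha.2 b hb.1 (Ne.symm hne)) (hb.2 a ha.1 hne)
  calc _ ≤ (1 : ℝ) * μ y := by gcongr; · exact hμ y
                               · exact_mod_cast this
    _ = μ y := one_mul _

/-- Under a maximal coupling of `Y` and `Ŷ`, the codeword `x` is decoded correctly from `Ŷ` at
least as often as from `Y`. -/
lemma correctMass_margY_le {q : X → Y → ℝ} {P : X → Y × Y → ℝ} (hP : P ∈ maximalJoint q)
    (C : Finset (Fin n → X)) (x : Fin n → X) :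
    correctMass q C x (blockLaw (margY P) x) ≤ correctMass q C x (blockLaw (margYhat P) x) := by
  have h1 : ∀ y, blockLaw (margY P) x y = ∑ y' : Fin n → Y, ∏ i, P (x i) (y i, y' i) :=
    fun y => Fintype.prod_sum fun i k => P (x i) (y i, k)
  have h2 : ∀ y', blockLaw (margYhat P) x y' = ∑ y : Fin n → Y, ∏ i, P (x i) (y i, y' i) :=
    fun y' => Fintype.prod_sum fun i k => P (x i) (k, y' i)
  -- Output pairs on which only `y` decodes correctly must break maximality at some position, so
  -- they carry no coupling mass.
  have h3 : ∀ y y' : Fin n → Y, DecodesCorrectly q C x y → ¬ DecodesCorrectly q C x y' →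
      ∏ i, P (x i) (y i, y' i) = 0 := by
    intro y y' hy hy'
    by_contra h0
    refine hy' (hy.of_mem_argmaxSet fun i => ?_)
    by_contra hi
    exact h0 (Finset.prod_eq_zero (Finset.mem_univ i) (hP.2 _ _ _ hi))
  have h4 : ∀ y y' : Fin n → Y, 0 ≤ ∏ i, P (x i) (y i, y' i) :=
    fun y y' => Finset.prod_nonneg fun i _ => (hP.1 (x i)).1 _
  classical
  calc correctMass q C x (blockLaw (margY P) x)
      = ∑ y : Fin n → Y, ∑ y' : Fin n → Y,
          if DecodesCorrectly q C x y then ∏ i, P (x i) (y i, y' i) else 0 := by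
        unfold correctMass
        refine Finset.sum_congr rfl fun y _ => ?_
        rw [h1]
        split_ifs <;> simp
    _ ≤ ∑ y : Fin n → Y, ∑ y' : Fin n → Y,
          if DecodesCorrectly q C x y' then ∏ i, P (x i) (y i, y' i) else 0 := by
        refine Finset.sum_le_sum fun y _ => Finset.sum_le_sum fun y' _ => ?_
        split_ifs with hy hy' hy'
        · exact le_rfl
        · exact (h3 y y' hy hy').le
        · exact h4 y y'
        · exact le_rfl
    _ = correctMass q C x (blockLaw (margYhat P) x) := by
        unfold correctMass
        rw [Finset.sum_comm]
        refine Finset.sum_congr rfl fun y' _ => ?_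
        rw [h2]
        split_ifs <;> simp

lemma avgError_eq {W : X → Y → ℝ} (hW : IsChannel W) (q : X → Y → ℝ) {n : ℕ}
    {C : Finset (Fin n → X)} (hC : 0 < C.card) :
    avgError W q C = 1 - (∑ x ∈ C, correctMass q C x (blockLaw W x)) / C.card := by
  have : (C.card : ℝ) ≠ 0 := by exact_mod_cast hC.ne'
  unfold avgError
  simp_rw [errorProb_eq hW]
  rw [Finset.sum_sub_distrib, Finset.sum_const, nsmul_one, sub_div, div_self this]

lemma avgError_le_maxError {W q : X → Y → ℝ} {n : ℕ} {C : Finset (Fin n → X)}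
    (hC : 0 < C.card) : avgError W q C ≤ maxError W q C := by
  refine (div_le_iff₀ (by exact_mod_cast hC)).2 ?_
  rw [mul_comm, ← nsmul_eq_mul]
  exact Finset.sum_le_card_nsmul _ _ _ fun x hx =>
    le_ciSup (f := fun x : C => errorProb W q C x) (Set.finite_range _).bddAbove ⟨x, hx⟩

lemma avgError_singleton {W q : X → Y → ℝ} {n : ℕ} (x : Fin n → X) :
    avgError W q {x} = 0 := by
  have : ∀ y, DecodesCorrectly q {x} x y := fun y x' hx' hne =>
    (hne (Finset.mem_singleton.1 hx')).elim
  simp [avgError, errorProb, this]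

lemma avgError_le_one {W : X → Y → ℝ} (hW : IsChannel W) (q : X → Y → ℝ) {n : ℕ}
    (C : Finset (Fin n → X)) : avgError W q C ≤ 1 := by
  rcases C.card.eq_zero_or_pos with h | h
  · simp [avgError, h]
  · rw [avgError_eq hW q h, sub_le_self_iff]
    exact div_nonneg (Finset.sum_nonneg fun x _ => correctMass_nonneg (blockLaw_nonneg hW x))
      (Nat.cast_nonneg _)

end Decoding

-- Change of measure to a fixed output law

section ChangeOfMeasure

variable {X Y : Type*} [Fintype Y] {n : ℕ}

/-- Correct decoding over `V` compared with an output distribution `Q` that ignores the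
codeword. -/
lemma correctMass_le_of_output {V : X → Y → ℝ} (hV : IsChannel V) {Q : Y → ℝ}
    (hQ : ∀ k, 0 < Q k) {s τ : ℝ} (hs : 0 < s) (hτ : 0 < τ) (q : X → Y → ℝ)
    (C : Finset (Fin n → X)) (x : Fin n → X) :
    correctMass q C x (blockLaw V x) ≤
      τ ^ (-s) * ∏ i, ∑ k, V (x i) k * (V (x i) k / Q k) ^ s +
        τ * correctMass q C x fun y => ∏ i, Q (y i) := by
  have key : ∀ y, blockLaw V x y ≤
      τ ^ (-s) * ∏ i, (V (x i) (y i) * (V (x i) (y i) / Q (y i)) ^ s) + τ * ∏ i, Q (y i) := by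
    intro y
    have hv := blockLaw_nonneg hV x y
    have hq : 0 < ∏ i, Q (y i) := Finset.prod_pos fun i _ => hQ _
    have e : τ ^ (-s) * ∏ i, (V (x i) (y i) * (V (x i) (y i) / Q (y i)) ^ s) =
        blockLaw V x y * (blockLaw V x y / (τ * ∏ i, Q (y i))) ^ s := by
      rw [Finset.prod_mul_distrib, Real.finsetProd_rpow _ _
        fun i _ => div_nonneg ((hV _).1 _) (hQ _).le, Finset.prod_div_distrib,
        Real.rpow_neg hτ.le, ← div_div, div_right_comm, Real.div_rpow (div_nonneg hv hq.le) hτ.le]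
      unfold blockLaw
      ring
    rw [e]
    -- Either `V^n ≤ τ Q^n`, or the ratio raised to the power `s` is at least one, as in Markov's
    -- inequality.
    rcases le_total (blockLaw V x y) (τ * ∏ i, Q (y i)) with h | h
    · have : 0 ≤ blockLaw V x y * (blockLaw V x y / (τ * ∏ i, Q (y i))) ^ s := by positivity
      linarith
    · have h1 : 1 ≤ (blockLaw V x y / (τ * ∏ i, Q (y i))) ^ s :=
        Real.one_le_rpow ((one_le_div (by positivity)).2 h) hs.le
      nlinarith [mul_pos hτ hq]
  unfold correctMass
  rw [Fintype.prod_sum fun i k => V (x i) k * (V (x i) k / Q k) ^ s, Finset.mul_sum,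
    Finset.mul_sum, ← Finset.sum_add_distrib]
  refine Finset.sum_le_sum fun y _ => ?_
  have hnn : 0 ≤ τ ^ (-s) * ∏ i, (V (x i) (y i) * (V (x i) (y i) / Q (y i)) ^ s) :=
    mul_nonneg (Real.rpow_nonneg hτ.le _) (Finset.prod_nonneg fun i _ =>
      mul_nonneg ((hV _).1 _) (Real.rpow_nonneg (div_nonneg ((hV _).1 _) (hQ _).le) _))
  split_ifs
  · exact key y
  · simpa using hnn

lemma hasDerivAt_sum_mul_rpow {v Q : Y → ℝ} (hv : ∀ k, 0 ≤ v k) (hQ : ∀ k, 0 < Q k) :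
    HasDerivAt (fun s : ℝ => ∑ k, v k * (v k / Q k) ^ s)
      (∑ k, v k * Real.log (v k / Q k)) 0 := by
  refine HasDerivAt.fun_sum fun k _ => ?_
  rcases (hv k).eq_or_lt with h | h
  -- Here the summand vanishes identically, so the non-differentiability of `0 ^ s` at `0` is
  -- harmless.
  · simpa [← h] using hasDerivAt_const (0 : ℝ) (0 : ℝ)
  · have := ((Real.hasStrictDerivAt_const_rpow (div_pos h (hQ k)) 0).hasDerivAt).const_mul (v k)
    simpa using this

/-- Small tilted moments of the likelihood ratio exceed the exponential of the divergence by an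
arbitrarily small factor. -/
lemma eventually_sum_mul_rpow_le_exp {v Q : Y → ℝ} (hv : v ∈ stdSimplex ℝ Y)
    (hQ : ∀ k, 0 < Q k) {c : ℝ} (hc : ∑ k, v k * Real.log (v k / Q k) < c) :
    ∀ᶠ s in 𝓝[>] (0 : ℝ), ∑ k, v k * (v k / Q k) ^ s ≤ Real.exp (s * c) := by
  have h1 := hasDerivAt_sum_mul_rpow hv.1 hQ
  -- Both sides equal one at `s = 0`, and the exponential has the strictly larger derivative there.
  have h2 : HasDerivAt (fun s : ℝ => Real.exp (s * c)) c 0 := by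
    simpa using ((hasDerivAt_id (0 : ℝ)).mul_const c).exp
  have h3 := (hasDerivAt_iff_tendsto_slope.1 (h2.sub h1)).eventually
    (eventually_gt_nhds (sub_pos.2 hc))
  filter_upwards [nhdsGT_le_nhdsNE _ h3, self_mem_nhdsWithin] with s hs (hs0 : 0 < s)
  have hone : ∑ k, v k = 1 := hv.2
  simp only [slope_def_field, Pi.sub_apply, zero_mul, Real.exp_zero, Real.rpow_zero, mul_one,
    hone, sub_self, sub_zero] at hs
  have := (div_pos_iff_of_pos_right hs0).1 hs
  linarith

/-- A fully supported output distribution relative to which the divergence of `V` is nearly the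
mutual information. -/
lemma exists_pos_output [Fintype X] [Nonempty Y] {p : X → ℝ} (hp : p ∈ stdSimplex ℝ X)
    {V : X → Y → ℝ} (hV : IsChannel V) {ρ : ℝ} (h : mutualInfo p V < ρ) :
    ∃ Q : Y → ℝ, (∀ k, 0 < Q k) ∧ ∑ k, Q k = 1 ∧
      ∑ j, p j * ∑ k, V j k * Real.log (V j k / Q k) < ρ * Real.log 2 := by
  have hl : 0 < Real.log 2 := Real.log_pos one_lt_two
  set d := (ρ - mutualInfo p V) * Real.log 2 with hd
  have hd0 : 0 < d := mul_pos (sub_pos.2 h) hl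
  -- Mixing the output law with weight `e` into the uniform law costs at most `d / 2` in the
  -- logarithm. Full support keeps the ratios meaningful even for letters that `p` does not use.
  set e := Real.exp (-(d / 2)) with he
  have he0 : 0 < e := Real.exp_pos _
  have he1 : e < 1 := by
    rw [he, ← Real.exp_zero]
    exact Real.exp_lt_exp.2 (by linarith)
  set O : Y → ℝ := fun k => ∑ j, p j * V j k with hO
  have hO0 : ∀ k, 0 ≤ O k := fun k => Finset.sum_nonneg fun j _ => mul_nonneg (hp.1 j) ((hV j).1 k)
  have hO1 : ∑ k, O k = 1 := by
    rw [hO, Finset.sum_comm]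
    simp_rw [← Finset.mul_sum]
    simp [(hV _).2, hp.2]
  have hY : (0 : ℝ) < Fintype.card Y := by exact_mod_cast Fintype.card_pos
  have hQ : ∀ k, 0 < e * O k + (1 - e) / Fintype.card Y := fun k =>
    add_pos_of_nonneg_of_pos (mul_nonneg he0.le (hO0 k)) (div_pos (sub_pos.2 he1) hY)
  refine ⟨fun k => e * O k + (1 - e) / Fintype.card Y, hQ, ?_, ?_⟩
  · rw [Finset.sum_add_distrib, ← Finset.mul_sum, hO1, Finset.sum_const, nsmul_eq_mul,
      Finset.card_univ, mul_div_cancel₀ _ hY.ne']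
    ring
  · have hterm : ∀ j k, p j * (V j k * Real.log (V j k / (e * O k + (1 - e) / Fintype.card Y))) ≤
        p j * V j k * Real.logb 2 (V j k / O k) * Real.log 2 + p j * V j k * (d / 2) := by
      intro j k
      have hpv := mul_nonneg (hp.1 j) ((hV j).1 k)
      rcases hpv.eq_or_lt with h0 | h0
      · rw [← mul_assoc, ← h0]; simp
      · have hOk : 0 < O k := h0.trans_le (Finset.single_le_sum (f := fun j' => p j' * V j' k)
          (fun i _ => mul_nonneg (hp.1 i) ((hV i).1 k)) (Finset.mem_univ j))
        have hv : 0 < V j k := pos_of_mul_pos_right h0 (hp.1 j)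
        have hlog : Real.log (e * O k) ≤ Real.log (e * O k + (1 - e) / Fintype.card Y) :=
          Real.log_le_log (mul_pos he0 hOk)
            (le_add_of_nonneg_right (div_nonneg (sub_nonneg.2 he1.le) hY.le))
        rw [Real.log_mul he0.ne' hOk.ne', he, Real.log_exp] at hlog
        rw [← mul_assoc, mul_assoc _ (Real.logb _ _), Real.logb, div_mul_cancel₀ _ hl.ne',
          ← mul_add, Real.log_div hv.ne' (hQ k).ne', Real.log_div hv.ne' hOk.ne']
        exact mul_le_mul_of_nonneg_left (by linarith) hpv
    have hsum : ∑ j, ∑ k, p j * V j k * (d / 2) = d / 2 := by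
      simp_rw [← Finset.sum_mul, ← Finset.mul_sum]
      simp [(hV _).2, hp.2]
    calc _ = ∑ j, ∑ k, p j * (V j k * Real.log (V j k / (e * O k + (1 - e) / Fintype.card Y))) := by
          simp_rw [Finset.mul_sum]
      _ ≤ ∑ j, ∑ k, (p j * V j k * Real.logb 2 (V j k / O k) * Real.log 2 +
            p j * V j k * (d / 2)) :=
          Finset.sum_le_sum fun j _ => Finset.sum_le_sum fun k _ => hterm j k
      _ = mutualInfo p V * Real.log 2 + d / 2 := by
          simp_rw [Finset.sum_add_distrib]
          rw [hsum, mutualInfo]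
          simp_rw [Finset.sum_mul]
          rfl
      _ < ρ * Real.log 2 := by
          have : ρ * Real.log 2 = mutualInfo p V * Real.log 2 + d := by rw [hd]; ring
          linarith

end ChangeOfMeasure

-- Strong converse and the capacity bound

section StrongConverse

variable {X Y : Type*} [Fintype X] [Fintype Y]

/-- The empirical distribution of a word. -/
noncomputable def empiricalDist [DecidableEq X] {n : ℕ} (x : Fin n → X) (j : X) : ℝ :=
  (∑ i, if x i = j then 1 else 0) / n

lemma sum_empiricalDist_mul [DecidableEq X] {n : ℕ} (hn : 0 < n) (x : Fin n → X) (c : X → ℝ) :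
    n * ∑ j, empiricalDist x j * c j = ∑ i, c (x i) := by
  have hn' : (n : ℝ) ≠ 0 := by exact_mod_cast hn.ne'
  unfold empiricalDist
  simp_rw [div_mul_eq_mul_div, ← Finset.sum_div, mul_div_cancel₀ _ hn', Finset.sum_mul]
  rw [Finset.sum_comm]
  simp

lemma empiricalDist_mem [DecidableEq X] {n : ℕ} (hn : 0 < n) (x : Fin n → X) :
    empiricalDist x ∈ stdSimplex ℝ X := by
  have hn' : (n : ℝ) ≠ 0 := by exact_mod_cast hn.ne'
  refine ⟨fun j => div_nonneg (Finset.sum_nonneg fun i _ => by split_ifs <;> simp) n.cast_nonneg,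
    mul_left_cancel₀ hn' ?_⟩
  simpa using sum_empiricalDist_mul hn x fun _ => 1

/-- The bound is stated letter by letter so that the data chosen at `p` also serve nearby types: for
a word of type `p'` the product of the moments is at most `exp (s * n * ∑ j, p' j * c j)`, whose
exponent is linear in `p'`. -/
lemma exists_feasible_tilted_le [Nonempty X] {W : X → Y → ℝ} (hW : IsChannel W) (q : X → Y → ℝ)
    {ρ : ℝ} (hρ : Rbar W q < ρ) {p : X → ℝ} (hp : p ∈ stdSimplex ℝ X) :
    ∃ (P : X → Y × Y → ℝ) (Q : Y → ℝ) (s : ℝ) (c : X → ℝ), P ∈ feasible W q ∧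
      (∀ k, 0 < Q k) ∧ ∑ k, Q k = 1 ∧ 0 < s ∧
      (∀ j, ∑ k, margYhat P j k * (margYhat P j k / Q k) ^ s ≤ Real.exp (s * c j)) ∧
      ∑ j, p j * c j < ρ * Real.log 2 := by
  obtain ⟨P, hP, hI⟩ := (isLeast_innerMin hW q hp).1
  have hV := margYhat_isChannel hP.1.1
  have : Nonempty Y := by
    by_contra h
    rw [not_nonempty_iff] at h
    simpa using (hW (Classical.arbitrary X)).2
  have hlt : mutualInfo p (margYhat P) < ρ :=
    (hI.le.trans ((isGreatest_Rbar W q).2 ⟨p, hp, rfl⟩)).trans_lt hρ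
  obtain ⟨Q, hQ, hQ1, hD⟩ := exists_pos_output hp hV hlt
  obtain ⟨d, hd1, hd2⟩ := exists_between hD
  set δ := d - ∑ j, p j * ∑ k, margYhat P j k * Real.log (margYhat P j k / Q k) with hδ
  have hδ0 : 0 < δ := sub_pos.2 hd1
  have hev : ∀ᶠ s in 𝓝[>] (0 : ℝ), ∀ j, ∑ k, margYhat P j k * (margYhat P j k / Q k) ^ s ≤
      Real.exp (s * (∑ k, margYhat P j k * Real.log (margYhat P j k / Q k) + δ)) :=
    eventually_all.2 fun j => eventually_sum_mul_rpow_le_exp (hV j) hQ (lt_add_of_pos_right _ hδ0)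
  obtain ⟨s, hs, hs0⟩ := (hev.and self_mem_nhdsWithin).exists
  refine ⟨P, Q, s, _, hP, hQ, hQ1, hs0, hs, ?_⟩
  simp_rw [mul_add]
  rw [Finset.sum_add_distrib, ← Finset.sum_mul, hp.2, hδ]
  linarith

/-- The number of codewords decoded correctly on average, bounded by a vanishing fraction of the
codebook plus about `2^{n R̄_q(W)}`. -/
lemma exists_sum_correctMass_le [Nonempty X] {W : X → Y → ℝ} (hW : IsChannel W) (q : X → Y → ℝ)
    {ρ : ℝ} (hρ : Rbar W q < ρ) :
    ∃ κ : ℝ, 0 < κ ∧ ∃ K : ℕ, ∀ n : ℕ, 0 < n → ∀ C : Finset (Fin n → X),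
      ∑ x ∈ C, correctMass q C x (blockLaw W x) ≤
        C.card * Real.exp (-(n * κ)) + K * Real.exp (n * (ρ * Real.log 2)) := by
  classical
  obtain ⟨σ, hσ1, hσ2⟩ := exists_between hρ
  choose! P Q s c hP hQ hQ1 hs hg hc using
    fun (p : X → ℝ) (hp : p ∈ stdSimplex ℝ X) => exists_feasible_tilted_le hW q hσ1 hp
  obtain ⟨t, htΔ, ht⟩ := (isCompact_stdSimplex ℝ X).elim_nhds_subcover
    (fun p => {p' | ∑ j, p' j * c p j < σ * Real.log 2})
    fun p hp => (isOpen_lt (by fun_prop) continuous_const).mem_nhds (hc p hp)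
  have hne : t.Nonempty := by
    obtain ⟨p, hp, -⟩ := Set.mem_iUnion₂.1
      (ht (single_mem_stdSimplex ℝ (Classical.arbitrary X)))
    exact ⟨p, hp⟩
  -- The smallest tilt among the finitely many centres gives one exponent valid for all words.
  obtain ⟨a₀, ha₀, hmin⟩ := t.exists_min_image s hne
  have hl : 0 < Real.log 2 := Real.log_pos one_lt_two
  have hgap : 0 < ρ * Real.log 2 - σ * Real.log 2 := sub_pos.2 (mul_lt_mul_of_pos_right hσ2 hl)
  refine ⟨s a₀ * (ρ * Real.log 2 - σ * Real.log 2), mul_pos (hs _ (htΔ _ ha₀)) hgap, t.card,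
    fun n hn C => ?_⟩
  have hQn : ∀ a ∈ t, ∀ y : Fin n → Y, 0 ≤ ∏ i, Q a (y i) :=
    fun a ha y => Finset.prod_nonneg fun i _ => (hQ a (htΔ a ha) _).le
  have hword : ∀ x : Fin n → X, correctMass q C x (blockLaw W x) ≤
      Real.exp (-(n * (s a₀ * (ρ * Real.log 2 - σ * Real.log 2)))) +
        Real.exp (n * (ρ * Real.log 2)) *
          ∑ a ∈ t, correctMass q C x fun y => ∏ i, Q a (y i) := by
    intro x
    obtain ⟨a, ha, hax⟩ := Set.mem_iUnion₂.1 (ht (empiricalDist_mem hn x))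
    have haΔ := htΔ a ha
    have hsa := hs a haΔ
    have hV := margYhat_isChannel (hP a haΔ).1.1
    have h1 := correctMass_margY_le (hP a haΔ).1 C x
    rw [(hP a haΔ).2] at h1
    -- The threshold is `τ = 2^{nρ}`; against moments of order `2^{snσ}` it leaves the factor
    -- `2^{-sn(ρ-σ)}`.
    have h2 := correctMass_le_of_output hV (hQ a haΔ) hsa
      (Real.exp_pos (n * (ρ * Real.log 2))) q C x
    have h3 : ∏ i, ∑ k, margYhat (P a) (x i) k * (margYhat (P a) (x i) k / Q a k) ^ s a ≤
        Real.exp (s a * (n * (σ * Real.log 2))) := by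
      calc _ ≤ ∏ i, Real.exp (s a * c a (x i)) :=
            Finset.prod_le_prod (fun i _ => Finset.sum_nonneg fun k _ =>
              mul_nonneg ((hV _).1 k) (Real.rpow_nonneg
                (div_nonneg ((hV _).1 k) (hQ a haΔ k).le) _)) fun i _ => hg a haΔ (x i)
        _ = Real.exp (s a * (n * ∑ j, empiricalDist x j * c a j)) := by
            rw [← Real.exp_sum, ← Finset.mul_sum, sum_empiricalDist_mul hn]
        _ ≤ _ := by
            have : ∑ j, empiricalDist x j * c a j ≤ σ * Real.log 2 := le_of_lt hax
            gcongr
    have h4 : Real.exp (n * (ρ * Real.log 2)) ^ (-s a) *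
        ∏ i, ∑ k, margYhat (P a) (x i) k * (margYhat (P a) (x i) k / Q a k) ^ s a ≤
        Real.exp (-(n * (s a₀ * (ρ * Real.log 2 - σ * Real.log 2)))) := by
      refine (mul_le_mul_of_nonneg_left h3 (by positivity)).trans ?_
      rw [← Real.exp_mul, ← Real.exp_add, Real.exp_le_exp]
      have := mul_le_mul_of_nonneg_left (mul_le_mul_of_nonneg_right (hmin a ha) hgap.le)
        (Nat.cast_nonneg (α := ℝ) n)
      linarith
    have h5 : (correctMass q C x fun y => ∏ i, Q a (y i)) ≤
        ∑ a ∈ t, correctMass q C x fun y => ∏ i, Q a (y i) :=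
      Finset.single_le_sum (f := fun a => correctMass q C x fun y => ∏ i, Q a (y i))
        (fun b hb => correctMass_nonneg (hQn b hb)) ha
    exact h1.trans (h2.trans (add_le_add h4 (mul_le_mul_of_nonneg_left h5 (Real.exp_pos _).le)))
  have hout : ∑ x ∈ C, ∑ a ∈ t, (correctMass q C x fun y => ∏ i, Q a (y i)) ≤ t.card := by
    rw [Finset.sum_comm, Finset.card_eq_sum_ones, Nat.cast_sum]
    refine Finset.sum_le_sum fun a ha => (sum_correctMass_le q C (hQn a ha)).trans_eq ?_
    rw [← Fintype.prod_sum fun (_ : Fin n) k => Q a k]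
    simp [hQ1 a (htΔ a ha)]
  refine (Finset.sum_le_sum fun x _ => hword x).trans ?_
  rw [Finset.sum_add_distrib, Finset.sum_const, nsmul_eq_mul, ← Finset.mul_sum,
    mul_comm (t.card : ℝ)]
  gcongr

lemma two_rpow_eq_exp (u : ℝ) : (2 : ℝ) ^ u = Real.exp (u * Real.log 2) := by
  rw [Real.rpow_def_of_pos two_pos, mul_comm]

/-- The exponential strong converse, for the average error probability. -/
theorem exists_le_avgError [Nonempty X] {W : X → Y → ℝ} (hW : IsChannel W) (q : X → Y → ℝ)
    {R : ℝ} (hR : Rbar W q < R) :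
    ∃ n₀ : ℕ, ∃ E : ℝ, 0 < E ∧ ∀ n : ℕ, n₀ < n → ∀ C : Finset (Fin n → X),
      (2 : ℝ) ^ ((n : ℝ) * R) ≤ (C.card : ℝ) →
      1 - (2 : ℝ) ^ (-((n : ℝ) * E)) ≤ avgError W q C := by
  obtain ⟨ρ, hρ1, hρ2⟩ := exists_between hR
  obtain ⟨κ, hκ, K, hb⟩ := exists_sum_correctMass_le hW q hρ1
  have hl : 0 < Real.log 2 := Real.log_pos one_lt_two
  set e := min κ ((R - ρ) * Real.log 2) with he
  have he0 : 0 < e := lt_min hκ (mul_pos (sub_pos.2 hρ2) hl)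
  -- Half of the exponent `e` is given up to absorb the constant `1 + K`.
  have htend : Tendsto (fun n : ℕ => Real.exp (n * (e / 2))) atTop atTop :=
    Real.tendsto_exp_atTop.comp (tendsto_natCast_atTop_atTop.atTop_mul_const (half_pos he0))
  obtain ⟨n₀, hn₀⟩ := eventually_atTop.1 (htend.eventually_ge_atTop (1 + K))
  refine ⟨n₀, e / 2 / Real.log 2, by positivity, fun n hn C hC => ?_⟩
  have hcard : (0 : ℝ) < C.card := (Real.rpow_pos_of_pos two_pos _).trans_le hC
  rw [avgError_eq hW q (by exact_mod_cast hcard)]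
  refine sub_le_sub_left ((div_le_iff₀ hcard).2 ((hb n (by omega) C).trans ?_)) 1
  rw [two_rpow_eq_exp] at hC ⊢
  have hE : -((n : ℝ) * (e / 2 / Real.log 2)) * Real.log 2 = -(n * e) + n * (e / 2) := by
    field_simp
    ring
  have hn0 : (0 : ℝ) ≤ n := n.cast_nonneg
  have h1 : Real.exp (-(n * κ)) ≤ Real.exp (-(n * e)) :=
    Real.exp_le_exp.2 (neg_le_neg (mul_le_mul_of_nonneg_left (min_le_left _ _) hn0))
  have h2 : Real.exp (n * (ρ * Real.log 2)) ≤ C.card * Real.exp (-(n * e)) := by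
    refine le_trans ?_ (mul_le_mul_of_nonneg_right hC (Real.exp_pos _).le)
    rw [← Real.exp_add, Real.exp_le_exp]
    have := mul_le_mul_of_nonneg_left (min_le_right κ ((R - ρ) * Real.log 2)) hn0
    rw [← he] at this
    linarith
  calc (C.card : ℝ) * Real.exp (-(n * κ)) + K * Real.exp (n * (ρ * Real.log 2))
      ≤ C.card * Real.exp (-(n * e)) + K * (C.card * Real.exp (-(n * e))) := by gcongr
    _ = C.card * Real.exp (-(n * e)) * (1 + K) := by ring
    _ ≤ C.card * Real.exp (-(n * e)) * Real.exp (n * (e / 2)) := by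
        gcongr
        exact hn₀ n hn.le
    _ = Real.exp (-((n : ℝ) * (e / 2 / Real.log 2)) * Real.log 2) * C.card := by
        rw [hE, Real.exp_add]
        ring

lemma two_rpow_neg_tendsto {E : ℝ} (hE : 0 < E) :
    Tendsto (fun n : ℕ => (2 : ℝ) ^ (-((n : ℝ) * E))) atTop (𝓝 0) := by
  simp_rw [two_rpow_eq_exp]
  refine Real.tendsto_exp_atBot.comp ?_
  refine Tendsto.atBot_mul_const (Real.log_pos one_lt_two) ?_
  exact tendsto_neg_atTop_atBot.comp (tendsto_natCast_atTop_atTop.atTop_mul_const hE)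

/-- If `R̄_q(W)` were negative, the strong converse would fail for one-word codebooks. -/
lemma Rbar_nonneg [Nonempty X] {W : X → Y → ℝ} (hW : IsChannel W) (q : X → Y → ℝ) :
    0 ≤ Rbar W q := by
  by_contra! h
  obtain ⟨n₀, E, hE, hb⟩ := exists_le_avgError hW q h
  have h1 := hb (n₀ + 1) n₀.lt_succ_self {fun _ => Classical.arbitrary X} (by simp)
  rw [avgError_singleton] at h1
  have : (2 : ℝ) ^ (-(((n₀ + 1 : ℕ) : ℝ) * E)) < 1 :=
    Real.rpow_lt_one_of_one_lt_of_neg one_lt_two (neg_lt_zero.2 (by positivity))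
  linarith

lemma Achievable.le_Rbar [Nonempty X] {W : X → Y → ℝ} (hW : IsChannel W) {q : X → Y → ℝ} {R : ℝ}
    (h : Achievable W q R) : R ≤ Rbar W q := by
  by_contra! hR
  obtain ⟨C, hC, hlim⟩ := h.2 ((R - Rbar W q) / 2) (by linarith)
  obtain ⟨n₀, E, hE, hb⟩ := exists_le_avgError hW q
    (show Rbar W q < R - (R - Rbar W q) / 2 by linarith)
  have hev : ∀ᶠ n : ℕ in atTop, 1 / 2 ≤ avgError W q (C n) := by
    filter_upwards [(two_rpow_neg_tendsto hE).eventually_le_const (show (0 : ℝ) < 1 / 2 by norm_num),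
      eventually_gt_atTop n₀] with n hn hn'
    have := hb n hn' (C n) (hC n (by omega))
    linarith
  -- A real `liminf` is only meaningful with this bound, which comes from the average error being at
  -- most one.
  have hcob : IsCoboundedUnder (· ≥ ·) atTop fun n => avgError W q (C n) :=
    IsBoundedUnder.isCoboundedUnder_ge
      (isBoundedUnder_of ⟨1, fun n => avgError_le_one hW q (C n)⟩)
  have := le_liminf_of_le hcob hev
  rw [hlim] at this
  norm_num at this

end StrongConverse

end Mismatch

theorem theorem1 {X Y : Type*} [Fintype X] [Nonempty X] [Fintype Y]
    (W : X → Y → ℝ) (hW : Mismatch.IsChannel W) (q : X → Y → ℝ) :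
    -- the minimum and the maximum that define `R̄_q(W)` are attained
    (∀ p ∈ stdSimplex ℝ X,
      IsLeast (Mismatch.innerValues W q p) (Mismatch.innerMin W q p)) ∧
    IsGreatest (Mismatch.innerMin W q '' stdSimplex ℝ X) (Mismatch.Rbar W q) ∧
    -- above `R̄_q(W)` the maximal error probability tends to one exponentially fast
    (∀ R : ℝ, Mismatch.Rbar W q < R →
      ∃ n₀ : ℕ, ∃ E : ℝ, 0 < E ∧ ∀ n : ℕ, n₀ < n → ∀ C : Finset (Fin n → X),
        (2 : ℝ) ^ ((n : ℝ) * R) ≤ (C.card : ℝ) →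
        1 - (2 : ℝ) ^ (-((n : ℝ) * E)) ≤ Mismatch.maxError W q C) ∧
    -- no rate above `R̄_q(W)` is achievable, that is, `C_q(W) ≤ R̄_q(W)`
    (∀ R : ℝ, Mismatch.Achievable W q R → R ≤ Mismatch.Rbar W q) ∧
    Mismatch.mismatchCapacity W q ≤ Mismatch.Rbar W q := by
  refine ⟨fun p hp => Mismatch.isLeast_innerMin hW q hp, Mismatch.isGreatest_Rbar W q,
    fun R hR => ?_, fun R hR => hR.le_Rbar hW,
    -- Nonnegativity of `R̄_q(W)` covers the case of no achievable rate, where the supremum is `0`.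
    Real.sSup_le (fun R hR => hR.le_Rbar hW) (Mismatch.Rbar_nonneg hW q)⟩
  obtain ⟨n₀, E, hE, hb⟩ := Mismatch.exists_le_avgError hW q hR
  refine ⟨n₀, E, hE, fun n hn C hC => (hb n hn C hC).trans (Mismatch.avgError_le_maxError ?_)⟩
  exact_mod_cast (Real.rpow_pos_of_pos two_pos _).trans_le hC
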